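/- Let $N$ be a $\mathrm{II}_1$ factor (an infinite-dimensional von Neumann algebra with trivial centre which has a faithful normal tracial state, denoted $\mathrm{tr}$), and write $\|x\|_2=\mathrm{tr}(x^*x)^{1/2}$. For a projection $e\in N$ with $e\neq 0$, the corner $eNe$ has unit $e$ and carries the normalised trace $\mathrm{tr}(e)^{-1}\,\mathrm{tr}$. A centralising sequence for $N$ in a subset $B\subseteq N$ is a sequence $(x_n)_{n\ge 1}$ in $B$ with $\|x_ny-yx_n\|_2\to 0$ for every $y\in N$; it is trivial if there are scalars $\lambda_n\in\mathbb{C}$ with $\|x_n-\lambda_n 1\|_2\to 0$. The same terms are used in a corner $eNe$, with its own unit $e$ and trace. In the zero algebra $0N0$ the only sequence is the zero sequence, which is trivial. A masa in $N$ is a maximal abelian self-adjoint von Neumann subalgebra of $N$. For a masa $A$ in $N$, let $\Gamma(A)$ be the supremum of $\mathrm{tr}(q)$ over all projections $q\in A$ such that $Aq$ contains a non-trivial centralising sequence for $qNq$ (with $\sup\emptyset=0$). Say that $A$ is totally non-$\Gamma$ in $N$ if $\Gamma(A)=0$. For a projection $e\in A$, the invariant of $Ae$ in $eNe$ is defined in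 the same way, using the normalised trace of $eNe$; it is $0$ when $e=0$. **Lemma.** Let $A$ be a masa in a $\mathrm{II}_1$ factor $N$. Suppose that there is a projection $p\in A$ such that - $Ap$ contains a non-trivial centralising sequence for $pNp$; - $A(1-p)$ is totally non-$\Gamma$ in $(1-p)N(1-p)$. Then $\Gamma(A)=\mathrm{tr}(p)$. -/

import Mathlib

open Filter Topology
open scoped ComplexOrder

namespace MasaGamma

noncomputable section

/-! ### II₁ factors and masas, as concrete von Neumann algebras -/

section VN

variable {H : Type*} [NormedAddCommGroup H] [InnerProductSpace ℂ H] [CompleteSpace H]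

/-- `tr` is a faithful normal tracial state on the von Neumann algebra `N`. Normality is stated
as preservation of suprema of increasing (upward directed) families of positive elements, for the
usual (Loewner) order of operators. -/
structure IsFaithfulNormalTrace (N : VonNeumannAlgebra H)
    (tr : N.toStarSubalgebra →ₗ[ℂ] ℂ) : Prop where
  map_one : tr 1 = 1
  nonneg : ∀ x : N.toStarSubalgebra, 0 ≤ tr (star x * x)
  tracial : ∀ x y : N.toStarSubalgebra, tr (x * y) = tr (y * x)
  faithful : ∀ x : N.toStarSubalgebra, tr (star x * x) = 0 → x = 0
  normal : ∀ (S : Set N.toStarSubalgebra) (x : N.toStarSubalgebra), S.Nonempty →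
    (∀ s ∈ S, (0 : H →L[ℂ] H) ≤ s) → DirectedOn (· ≤ ·) S → IsLUB S x →
    IsLUB ((fun s => (tr s).re) '' S) (tr x).re

/-- `N` is a II₁ factor: an infinite-dimensional von Neumann algebra with trivial centre which
has a faithful normal tracial state. -/
structure IsII1Factor (N : VonNeumannAlgebra H) : Prop where
  factor : ∀ z : H →L[ℂ] H, z ∈ N → z ∈ N.commutant → ∃ c : ℂ, z = c • (1 : H →L[ℂ] H)
  infinite : ¬ FiniteDimensional ℂ N.toStarSubalgebra
  exists_trace : ∃ tr : N.toStarSubalgebra →ₗ[ℂ] ℂ, IsFaithfulNormalTrace N tr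

/-- `A` is a masa in `N`: maximal among the abelian von Neumann subalgebras of `N`. -/
def IsMasa (N A : VonNeumannAlgebra H) : Prop :=
  Maximal (fun B : VonNeumannAlgebra H => B ≤ N ∧ ∀ x ∈ B, ∀ y ∈ B, x * y = y * x) A

/-- A von Neumann subalgebra `A` of `N`, as a set of elements of `N`. -/
def elementsOf (N A : VonNeumannAlgebra H) : Set N.toStarSubalgebra :=
  {x | (x : H →L[ℂ] H) ∈ A}

end VN

/-! ### Corners, centralising sequences and the invariant `Γ`

In this section `M` is an ambient `*`-algebra. A II₁ factor is given by its set of elements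
`N ⊆ M` and its trace (a linear functional), so that the notions apply both to the whole algebra
and to a corner `pNp`, whose unit is `p` and whose trace is the rescaled one. -/

section Gamma

variable {M : Type*} [Ring M] [StarRing M] [Algebra ℂ M]

/-- The Hilbert space norm `‖x‖₂ = tr(x* x)^{1/2}`. -/
def twoNorm (tr : M →ₗ[ℂ] ℂ) (x : M) : ℝ := Real.sqrt (tr (star x * x)).re

/-- The corner `eNe`. -/
def corner (N : Set M) (e : M) : Set M := {y | ∃ x ∈ N, y = e * x * e}

/-- The set `Be`, for `B` a set of elements. -/
def cut (B : Set M) (e : M) : Set M := {y | ∃ b ∈ B, y = b * e}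

/-- The normalised trace of the corner with unit `e`. -/
def cornerTrace (tr : M →ₗ[ℂ] ℂ) (e : M) : M →ₗ[ℂ] ℂ := (tr e)⁻¹ • tr

/-- `x` is a centralising sequence for `N` in the subset `B` of `N`. -/
def IsCentralising (tr : M →ₗ[ℂ] ℂ) (N B : Set M) (x : ℕ → M) : Prop :=
  (∀ n, x n ∈ B) ∧
    ∀ y ∈ N, Tendsto (fun n => twoNorm tr (x n * y - y * x n)) atTop (𝓝 0)

/-- `x` is a trivial sequence in an algebra with unit `e`: it is asymptotically scalar. -/
def IsTrivialSeq (tr : M →ₗ[ℂ] ℂ) (e : M) (x : ℕ → M) : Prop :=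
  ∃ c : ℕ → ℂ, Tendsto (fun n => twoNorm tr (x n - c n • e)) atTop (𝓝 0)

/-- For a projection `e` of the masa `B` in `N` (with trace `tr`): the algebra `Be` contains a
non-trivial centralising sequence for `eNe`. -/
def CutHasNontrivialCentralising (tr : M →ₗ[ℂ] ℂ) (N B : Set M) (e : M) : Prop :=
  ∃ x : ℕ → M, IsCentralising (cornerTrace tr e) (corner N e) (cut B e) x ∧
    ¬ IsTrivialSeq (cornerTrace tr e) e x

/-- `Γ(B)` for `B` in `N` (with trace `tr`): the supremum of `tr(q)` over all projections `q ∈ B`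
such that `Bq` contains non-trivial centralising sequences for `qNq`. -/
def Gamma (tr : M →ₗ[ℂ] ℂ) (N B : Set M) : ℝ :=
  sSup {t : ℝ | ∃ q ∈ B, IsStarProjection q ∧ CutHasNontrivialCentralising tr N B q ∧
    t = (tr q).re}

/-- `B` is totally non-`Γ` in `N`. -/
def IsTotallyNonGamma (tr : M →ₗ[ℂ] ℂ) (N B : Set M) : Prop := Gamma tr N B = 0

end Gamma

end

end MasaGamma

/-! The supremum is attained at `p`, so it suffices that every projection `q` admitted in it lies
under `p`. If not, `r = q(1-p)` is non-zero. Cutting a non-trivial centralising sequence `x_n` of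
`qNq` by `r` gives a centralising sequence of `rNr` in `Ar`. As `A(1-p)` is totally non-Γ and `r ≤
1-p`, this sequence is trivial: `x_n r - c_n r → 0`.

Triviality then spreads from `r` to `q`. In a factor with faithful trace, `1` is a finite sum of
terms `a r b` (`one_mem_of_mul_mul_mem`). Since `x_n` asymptotically commutes with `q a r q`, each
`(x_n - c_n q) a r b` tends to `0`; summing, `x_n - c_n q → 0`, a contradiction.

The finite sum comes from comparison of projections (`exists_partialIsometry`). An extreme point `T`
of the unit ball of `eNf` is a partial isometry with `(e - TT*) N (f - T*T) = 0`, and factoriality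
makes one of the two defects vanish. -/

namespace MasaGamma

/-! ### Weak operator compactness and extreme points -/

section Operators

open scoped InnerProductSpace

variable {H : Type*} [NormedAddCommGroup H] [InnerProductSpace ℂ H] [CompleteSpace H]

/-- A bounded sesquilinear form is the form of an operator. -/
theorem exists_operator_of_form (B : H → H → ℂ)
    (hadd : ∀ x y z, B x (y + z) = B x y + B x z)
    (hsmul : ∀ (c : ℂ) x y, B x (c • y) = c * B x y)
    (hadd' : ∀ x y z, B (x + y) z = B x z + B y z)
    (hsmul' : ∀ (c : ℂ) x y, B (c • x) y = star c * B x y)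
    (hB : ∀ x y, ‖B x y‖ ≤ ‖x‖ * ‖y‖) :
    ∃ T : H →L[ℂ] H, (∀ x y, ⟪x, T y⟫_ℂ = B x y) ∧ ‖T‖ ≤ 1 := by
  let L : H →ₗ⋆[ℂ] H →ₗ[ℂ] ℂ :=
    LinearMap.mk₂'ₛₗ (starRingEnd ℂ) (RingHom.id ℂ) B hadd' hsmul' hadd hsmul
  let L' : H →L⋆[ℂ] H →L[ℂ] ℂ := L.mkContinuous₂ 1 (fun x y => by
    rw [one_mul]; exact hB x y)
  let T := ContinuousLinearMap.adjoint (InnerProductSpace.continuousLinearMapOfBilin L')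
  have hT : ∀ x y, ⟪x, T y⟫_ℂ = B x y := fun x y => by
    rw [ContinuousLinearMap.adjoint_inner_right,
      InnerProductSpace.continuousLinearMapOfBilin_apply]
    rfl
  refine ⟨T, hT, T.opNorm_le_bound zero_le_one fun y => ?_⟩
  have h1 : ‖⟪T y, T y⟫_ℂ‖ ≤ ‖T y‖ * ‖y‖ := by rw [hT]; exact hB _ _
  rw [inner_self_eq_norm_sq_to_K, norm_pow, RCLike.norm_ofReal, abs_norm, pow_two] at h1
  rcases eq_or_lt_of_le (norm_nonneg (T y)) with h | h
  · rw [← h]; positivity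
  · rw [one_mul]; exact le_of_mul_le_mul_left h1 h

/-- The unit ball of the corner `eNf`, as a set of operators. -/
def cornerBall (N : VonNeumannAlgebra H) (e f : H →L[ℂ] H) : Set (H →L[ℂ] H) :=
  {T | T ∈ N ∧ e * T * f = T ∧ ‖T‖ ≤ 1}

/-- The sesquilinear form of an operator. -/
noncomputable def formMap : (H →L[ℂ] H) →ₗ[ℝ] (H → H → ℂ) where
  toFun T x y := ⟪x, T y⟫_ℂ
  map_add' S T := by ext x y; simp
  map_smul' c T := by
    ext x y
    simp [inner_smul_right_eq_smul]

omit [CompleteSpace H] in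
theorem formMap_injective : Function.Injective (formMap (H := H)) := fun S T h => by
  ext y
  exact ext_inner_left ℂ fun x => congrFun (congrFun h x) y

/-- Tychonoff: pointwise convergence of forms is weak operator convergence, and the bounds on forms
define a product of discs. The image is cut out by closed conditions; commutation with the commutant
encodes membership in `N`, by the double commutant property. -/
theorem isCompact_formMap_image_cornerBall (N : VonNeumannAlgebra H) {e f : H →L[ℂ] H}
    (he : star e = e) : IsCompact (formMap '' cornerBall N e f) := by
  have hsub : IsCompact (Set.univ.pi fun x : H => Set.univ.pi fun y : H =>
      Metric.closedBall (0 : ℂ) (‖x‖ * ‖y‖)) :=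
    isCompact_univ_pi fun x => isCompact_univ_pi fun y => isCompact_closedBall _ _
  have heq : formMap '' cornerBall N e f =
      {B : H → H → ℂ | (∀ x y z, B x (y + z) = B x y + B x z) ∧
        (∀ (c : ℂ) x y, B x (c • y) = c * B x y) ∧
        (∀ x y z, B (x + y) z = B x z + B y z) ∧
        (∀ (c : ℂ) x y, B (c • x) y = star c * B x y) ∧
        (∀ x y, ‖B x y‖ ≤ ‖x‖ * ‖y‖) ∧
        (∀ x y, B (e x) (f y) = B x y) ∧
        (∀ g ∈ N.commutant, ∀ x y, B x (g y) = B (star g x) y)} := by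
    ext B
    constructor
    · rintro ⟨T, ⟨hN, hef, hT⟩, rfl⟩
      refine ⟨fun x y z => ?_, fun c x y => ?_, fun x y z => ?_, fun c x y => ?_, fun x y => ?_,
        fun x y => ?_, fun g hg x y => ?_⟩
      · simp [formMap]
      · simp [formMap]
      · simp [formMap]
      · simp [formMap, mul_comm]
      · refine (norm_inner_le_norm _ _).trans ?_
        have := T.le_of_opNorm_le hT y
        rw [one_mul] at this
        gcongr
      · have := congrArg (fun S : H →L[ℂ] H => ⟪x, S y⟫_ℂ) hef
        simp only [mul_apply_eq_comp] at this
        rw [← ContinuousLinearMap.adjoint_inner_left, ← ContinuousLinearMap.star_eq_adjoint,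
          he] at this
        exact this
      · have h := VonNeumannAlgebra.mem_commutant_iff.1 hg T hN
        change ⟪x, (T * g) y⟫_ℂ = ⟪star g x, T y⟫_ℂ
        rw [h, ContinuousLinearMap.star_eq_adjoint, ContinuousLinearMap.adjoint_inner_left]
        rfl
    · rintro ⟨h1, h2, h3, h4, h5, h6, h7⟩
      obtain ⟨T, hT, hT1⟩ := exists_operator_of_form B h1 h2 h3 h4 h5
      refine ⟨T, ⟨?_, ?_, hT1⟩, by ext x y; exact hT x y⟩
      · rw [← VonNeumannAlgebra.commutant_commutant N, VonNeumannAlgebra.mem_commutant_iff]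
        intro g hg
        ext y
        refine ext_inner_left ℂ fun x => ?_
        change ⟪x, g (T y)⟫_ℂ = ⟪x, T (g y)⟫_ℂ
        rw [hT, h7 g hg, ← hT, ContinuousLinearMap.star_eq_adjoint,
          ContinuousLinearMap.adjoint_inner_left]
      · ext y
        refine ext_inner_left ℂ fun x => ?_
        change ⟪x, e (T (f y))⟫_ℂ = ⟪x, T y⟫_ℂ
        rw [hT, ← h6, ← hT, ← ContinuousLinearMap.adjoint_inner_left,
          ← ContinuousLinearMap.star_eq_adjoint, he]
  refine hsub.of_isClosed_subset ?_ ?_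
  · rw [heq]
    simp only [Set.ofPred_and, Set.ofPred_forall]
    have hev : ∀ x y : H, Continuous fun B : H → H → ℂ => B x y := fun x y =>
      (continuous_apply y).comp (continuous_apply x)
    refine IsClosed.inter ?_ <| IsClosed.inter ?_ <| IsClosed.inter ?_ <| IsClosed.inter ?_ <|
      IsClosed.inter ?_ <| IsClosed.inter ?_ ?_
    all_goals repeat refine isClosed_iInter fun _ => ?_
    all_goals first
      | exact isClosed_le (hev _ _).norm continuous_const
      | exact isClosed_eq (hev _ _) ((hev _ _).add (hev _ _))
      | exact isClosed_eq (hev _ _) (continuous_const.mul (hev _ _))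
      | exact isClosed_eq (hev _ _) (hev _ _)
  · rw [heq]
    rintro B ⟨-, -, -, -, h, -⟩ x - y -
    simpa using h x y

/-- The unit ball of a corner `eNf` has an extreme point. -/
theorem exists_extreme_cornerBall (N : VonNeumannAlgebra H) {e f : H →L[ℂ] H}
    (he : star e = e) : ∃ T ∈ cornerBall N e f, ∀ x : H →L[ℂ] H,
      T + x ∈ cornerBall N e f → T - x ∈ cornerBall N e f → x = 0 := by
  obtain ⟨_, ⟨T, hT, rfl⟩, hext⟩ :=
    (isCompact_formMap_image_cornerBall N (f := f) he).extremePoints_nonempty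
      ⟨_, 0, ⟨zero_mem _, by simp, by simp⟩, rfl⟩
  refine ⟨T, hT, fun x hp hm => ?_⟩
  have := hext ⟨_, hp, rfl⟩ ⟨_, hm, rfl⟩
    ⟨1 / 2, 1 / 2, by norm_num, by norm_num, by norm_num, by
      rw [← map_smul, ← map_smul, ← map_add]
      congr 1
      rw [← smul_add, add_add_sub_cancel, ← two_smul ℝ T, smul_smul]
      norm_num⟩
  simpa using formMap_injective this

end Operators

/-! ### Comparison of projections in a factor -/

section Comparison

open scoped InnerProductSpace

variable {H : Type*} [NormedAddCommGroup H] [InnerProductSpace ℂ H] [CompleteSpace H]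

theorem smul_mem_vonNeumann (N : VonNeumannAlgebra H) (c : ℂ) {x : H →L[ℂ] H} (hx : x ∈ N) :
    c • x ∈ N :=
  show c • x ∈ N.toStarSubalgebra from N.toStarSubalgebra.smul_mem hx c

theorem norm_le_one_iff_star_mul_self_le (T : H →L[ℂ] H) : ‖T‖ ≤ 1 ↔ star T * T ≤ 1 := by
  rw [← CStarAlgebra.norm_le_one_iff_of_nonneg _ (star_mul_self_nonneg T),
    CStarRing.norm_star_mul_self]
  constructor
  · intro h; nlinarith [norm_nonneg T]
  · intro h; nlinarith [norm_nonneg T]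

/-- An extreme point of the unit ball of a corner is a partial isometry. -/
theorem mul_star_mul_self_of_extreme {N : VonNeumannAlgebra H} {e f T : H →L[ℂ] H}
    (he : IsStarProjection e) (hf : IsStarProjection f) (hT : T ∈ cornerBall N e f)
    (hext : ∀ x : H →L[ℂ] H, T + x ∈ cornerBall N e f → T - x ∈ cornerBall N e f → x = 0) :
    T * (star T * T) = T := by
  obtain ⟨hTN, hef, hT1⟩ := hT
  have heT : e * T = T := by
    rw [← hef, ← mul_assoc, ← mul_assoc, he.isIdempotentElem.eq]
  have hTf : T * f = T := by
    rw [← hef, mul_assoc, hf.isIdempotentElem.eq]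
  -- Perturb `T` by `±Tw`. As `T*T = 1 - 2w`, one gets `|T(1+w)|² = 1 - 3w² - 2w³ ≤ 1`, while
  -- `T(1-w) = T(1+T*T)/2` is a product of contractions. Extremality gives `Tw = 0`.
  set w : H →L[ℂ] H := (1 / 2 : ℂ) • (1 - star T * T) with hw
  have h2w : w + w = 1 - star T * T := by
    rw [hw, ← add_smul]; norm_num
  have hws : star w = w := by simp [hw]
  have hwN : w ∈ N := smul_mem_vonNeumann N _
    (sub_mem (one_mem N) (mul_mem (star_mem hTN) hTN))
  have hw0 : 0 ≤ w := by
    have h1 : 0 ≤ w + w := by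
      rw [h2w, sub_nonneg]; exact (norm_le_one_iff_star_mul_self_le T).1 hT1
    have : w = (1 / 2 : ℝ) • (w + w) := by
      rw [← two_smul ℝ, smul_smul]; norm_num
    rw [this]
    exact smul_nonneg (by norm_num) h1
  have ha : star T * T = 1 - (w + w) := by rw [h2w]; abel
  have hx : T * w = 0 := by
    have hc : e * (T * w) * f = T * w := by
      have h3 : (T * w) * f = T * w := by
        rw [hw, mul_smul_comm, smul_mul_assoc, mul_sub, sub_mul, mul_one, hTf,
          mul_assoc, mul_assoc, hTf]
      rw [mul_assoc, h3, ← mul_assoc, heT]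
    refine hext _ ⟨add_mem hTN (mul_mem hTN hwN), ?_, ?_⟩
      ⟨sub_mem hTN (mul_mem hTN hwN), ?_, ?_⟩
    · rw [mul_add, add_mul, hef, hc]
    · rw [norm_le_one_iff_star_mul_self_le, ← sub_nonneg]
      have : 1 - star (T + T * w) * (T + T * w) =
          (star w * w + star w * w + star w * w) + (star w * w * w + star w * w * w) := by
        rw [star_add, star_mul, hws]
        calc 1 - (star T + w * star T) * (T + T * w)
            = 1 - (1 + w) * (star T * T) * (1 + w) := by noncomm_ring
          _ = _ := by rw [ha]; noncomm_ring
      rw [this]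
      have h1 := star_mul_self_nonneg w
      have h2 : 0 ≤ star w * w * w := star_left_conjugate_nonneg hw0 w
        |> fun h => by rwa [hws] at h ⊢
      positivity
    · rw [mul_sub, sub_mul, hef, hc]
    · have h1 : T - T * w = T * ((1 / 2 : ℂ) • (1 + star T * T)) := by
        rw [← mul_one_sub]
        congr 1
        rw [hw]
        module
      have h2 : ‖(1 / 2 : ℂ) • (1 + star T * T)‖ ≤ 1 := by
        rw [norm_smul]
        have h3 : ‖(1 : H →L[ℂ] H) + star T * T‖ ≤ 1 + 1 := by
          refine (norm_add_le _ _).trans (add_le_add ContinuousLinearMap.norm_id_le ?_)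
          rw [CStarRing.norm_star_mul_self]
          nlinarith [norm_nonneg T]
        norm_num
        linarith
      rw [h1]
      refine (norm_mul_le _ _).trans ?_
      nlinarith [norm_nonneg T, norm_nonneg ((1 / 2 : ℂ) • (1 + star T * T))]
  have : T * (w + w) = 0 := by rw [mul_add, hx, add_zero]
  rw [h2w, mul_sub, mul_one, sub_eq_zero] at this
  exact this.symm

/-- In a factor, two projections `e`, `f` with `eNf = 0` are not both non-zero. -/
theorem eq_zero_or_eq_zero_of_mul_mul_eq_zero {N : VonNeumannAlgebra H}
    (hfac : ∀ z : H →L[ℂ] H, z ∈ N → z ∈ N.commutant → ∃ c : ℂ, z = c • (1 : H →L[ℂ] H))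
    {e f : H →L[ℂ] H} (hf : f ∈ N) (h : ∀ x ∈ N, e * x * f = 0) : e = 0 ∨ f = 0 := by
  by_cases hf0 : f = 0
  · exact Or.inr hf0
  left
  -- The closed span of `N f H` is invariant under both `N` and its commutant, so its projection is
  -- central, hence scalar; it fixes a non-zero vector, so it is `1`. But `e` vanishes on this span.
  let K₀ : Submodule ℂ H := Submodule.span ℂ {v | ∃ x ∈ N, ∃ ξ, v = x (f ξ)}
  let K := K₀.topologicalClosure
  have : CompleteSpace K := K₀.isClosed_topologicalClosure.completeSpace_coe
  let P := K.starProjection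
  have hP : IsStarProjection P := isStarProjection_starProjection
  have hext : ∀ g : H →L[ℂ] H, (∀ x ∈ N, ∀ ξ, g (x (f ξ)) ∈ K) → ∀ v ∈ K, g v ∈ K := by
    intro g hg v hv
    have h1 : K₀ ≤ K.comap (g : H →ₗ[ℂ] H) := by
      refine Submodule.span_le.2 ?_
      rintro _ ⟨x, hx, ξ, rfl⟩
      exact hg x hx ξ
    exact K₀.topologicalClosure_minimal h1
      (K₀.isClosed_topologicalClosure.preimage g.continuous) hv
  have hgen : ∀ x ∈ N, ∀ ξ, x (f ξ) ∈ K := fun x hx ξ =>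
    K₀.le_topologicalClosure (Submodule.subset_span ⟨x, hx, ξ, rfl⟩)
  have hrange : ∀ g : H →L[ℂ] H, (∀ x ∈ N, ∀ ξ, g (x (f ξ)) ∈ K) →
      P.range ∈ Module.End.invtSubmodule (g : H →ₗ[ℂ] H) := by
    intro g hg
    rw [Submodule.range_starProjection, Module.End.mem_invtSubmodule]
    exact hext g hg
  have hPN : P ∈ N := (VonNeumannAlgebra.IsStarProjection.mem_iff hP N).2 fun g hg =>
    hrange g fun x hx ξ => by
      have h1 := congrArg (fun S : H →L[ℂ] H => S ξ)
        (VonNeumannAlgebra.mem_commutant_iff.1 hg (x * f) (mul_mem hx hf))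
      change x (f (g ξ)) = g (x (f ξ)) at h1
      rw [← h1]
      exact hgen x hx _
  have hPN' : P ∈ N.commutant :=
    (VonNeumannAlgebra.IsStarProjection.mem_iff hP _).2 fun g hg =>
      hrange g fun x hx ξ => by
        rw [VonNeumannAlgebra.commutant_commutant] at hg
        exact hgen (g * x) (mul_mem hg hx) ξ
  obtain ⟨c, hc⟩ := hfac P hPN hPN'
  have hPf : ∀ ξ, P (f ξ) = f ξ := fun ξ =>
    Submodule.starProjection_eq_self_iff.2 (hgen 1 (one_mem N) ξ)
  obtain ⟨ξ, hξ⟩ : ∃ ξ, f ξ ≠ 0 := by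
    by_contra! h0
    exact hf0 (ContinuousLinearMap.ext h0)
  have hc1 : c = 1 := by
    have h1 := hPf ξ
    rw [hc] at h1
    change c • f ξ = f ξ at h1
    have h2 : (c - 1) • f ξ = 0 := by rw [sub_smul, one_smul, h1, sub_self]
    exact sub_eq_zero.1 ((smul_eq_zero.1 h2).resolve_right hξ)
  have hKe : K ≤ LinearMap.ker (e : H →ₗ[ℂ] H) := by
    refine K₀.topologicalClosure_minimal (Submodule.span_le.2 ?_) e.isClosed_ker
    rintro _ ⟨x, hx, ξ, rfl⟩
    exact congrArg (fun S : H →L[ℂ] H => S ξ) (h x hx)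
  ext v
  refine hKe (Submodule.starProjection_eq_self_iff.1 (?_ : P v = v))
  rw [hc, hc1, one_smul]
  rfl

/-- Comparison of projections in a factor. -/
theorem exists_partialIsometry {N : VonNeumannAlgebra H}
    (hfac : ∀ z : H →L[ℂ] H, z ∈ N → z ∈ N.commutant → ∃ c : ℂ, z = c • (1 : H →L[ℂ] H))
    {e f : H →L[ℂ] H} (he : IsStarProjection e) (hf : IsStarProjection f)
    (heN : e ∈ N) (hfN : f ∈ N) :
    ∃ T ∈ N, e * T * f = T ∧ T * (star T * T) = T ∧ (T * star T = e ∨ star T * T = f) := by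
  obtain ⟨T, hT, hext⟩ := exists_extreme_cornerBall N (f := f) he.isSelfAdjoint.star_eq
  have hpi := mul_star_mul_self_of_extreme he hf hT hext
  obtain ⟨hTN, hef, hT1⟩ := hT
  refine ⟨T, hTN, hef, hpi, ?_⟩
  have he2 := he.isIdempotentElem.eq
  have hf2 := hf.isIdempotentElem.eq
  have hes := he.isSelfAdjoint.star_eq
  have hfs := hf.isSelfAdjoint.star_eq
  have heT : e * T = T := by rw [← hef, ← mul_assoc, ← mul_assoc, he2]
  have hTf : T * f = T := by rw [← hef, mul_assoc, hf2]
  have hsT : star T * e = star T := by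
    have := congrArg star heT; rwa [star_mul, hes] at this
  have hfT : f * star T = star T := by
    have := congrArg star hTf; rwa [star_mul, hfs] at this
  have hpi' : star T * T * star T = star T := by
    have := congrArg star hpi
    rwa [star_mul, star_mul, star_star] at this
  set d := f - star T * T with hd
  have hds : star d = d := by simp [hd, hfs]
  have hdd : d * d = d := by
    rw [hd, mul_sub, sub_mul, sub_mul, hf2, mul_assoc (star T) T f, hTf, ← mul_assoc f, hfT,
      ← mul_assoc (star T * T), hpi', sub_self, sub_zero]
  have hdf : d * f = d := by rw [hd, sub_mul, hf2, mul_assoc, hTf]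
  set g := e - T * star T with hg
  have heg : e * g = g := by rw [hg, mul_sub, he2, ← mul_assoc, heT]
  have hTg : star T * g = 0 := by rw [hg, mul_sub, hsT, ← mul_assoc, hpi', sub_self]
  have hdN : d ∈ N := sub_mem hfN (mul_mem (star_mem hTN) hTN)
  have hgN : g ∈ N := sub_mem heN (mul_mem hTN (star_mem hTN))
  have hf1 : f ≤ 1 := hf.le_one
  -- The ranges of `T` and `y` are orthogonal and `y*y ≤ d`, so `|T+y|² ≤ T*T + d = f`.
  have key : ∀ y ∈ N, star T * y = 0 → e * y = y → y * d = y → ‖y‖ ≤ 1 →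
      T + y ∈ cornerBall N e f := by
    intro y hyN hTy hey hyd hy1
    have hyf : y * f = y := by rw [← hyd, mul_assoc, hdf]
    refine ⟨add_mem hTN hyN, ?_, ?_⟩
    · rw [mul_add, add_mul, hef, hey, hyf]
    · rw [norm_le_one_iff_star_mul_self_le] at hy1 ⊢
      have h1 : star y * T = 0 := by
        have := congrArg star hTy; rwa [star_mul, star_star, star_zero] at this
      have h2 : star y * y ≤ d := by
        have := star_left_conjugate_le_conjugate hy1 d
        rw [hds, mul_one, hdd] at this
        rw [← hyd, star_mul, hds, mul_assoc]
        rwa [mul_assoc, mul_assoc] at this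
      calc star (T + y) * (T + y) = star T * T + star y * y := by
            rw [star_add, add_mul, mul_add, mul_add, hTy, h1, add_zero, zero_add]
        _ ≤ star T * T + d := by gcongr
        _ = f := by rw [hd]; abel
        _ ≤ 1 := hf1
  have hzero : ∀ x ∈ N, g * x * d = 0 := by
    intro x hxN
    set y := g * x * d with hy
    have hyN : y ∈ N := mul_mem (mul_mem hgN hxN) hdN
    -- Scaling to a contraction; the `1 +` keeps the denominator non-zero.
    set c : ℂ := ((1 + ‖y‖ : ℝ) : ℂ)⁻¹ with hc
    have hpos : 0 < 1 + ‖y‖ := by positivity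
    have hc0 : c ≠ 0 := inv_ne_zero (by exact_mod_cast hpos.ne')
    have hTy : star T * (c • y) = 0 := by
      rw [mul_smul_comm, hy, ← mul_assoc, ← mul_assoc, hTg, zero_mul, zero_mul, smul_zero]
    have hey : e * (c • y) = c • y := by
      rw [mul_smul_comm, hy, ← mul_assoc, ← mul_assoc, heg]
    have hyd : (c • y) * d = c • y := by rw [smul_mul_assoc, hy, mul_assoc, hdd]
    have hn : ‖c • y‖ ≤ 1 := by
      rw [norm_smul, hc, norm_inv, Complex.norm_real, Real.norm_of_nonneg hpos.le,
        inv_mul_le_iff₀ hpos]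
      linarith
    have hcN := smul_mem_vonNeumann N c hyN
    have := hext (c • y) (key _ hcN hTy hey hyd hn) (by
      rw [sub_eq_add_neg]
      exact key _ (neg_mem hcN) (by rw [mul_neg, hTy, neg_zero]) (by rw [mul_neg, hey])
        (by rw [neg_mul, hyd]) (by rwa [norm_neg]))
    exact (smul_eq_zero.1 this).resolve_left hc0
  rcases eq_zero_or_eq_zero_of_mul_mul_eq_zero hfac hdN hzero with h | h
  · exact Or.inl (sub_eq_zero.1 h).symm
  · exact Or.inr (sub_eq_zero.1 h).symm

end Comparison

/-! ### The trace, ideals and the Hilbert space norm -/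

section Trace

variable {H : Type*} [NormedAddCommGroup H] [InnerProductSpace ℂ H] [CompleteSpace H]
  {N : VonNeumannAlgebra H} {tr : N.toStarSubalgebra →ₗ[ℂ] ℂ}

theorem IsFaithfulNormalTrace.projection_nonneg (htr : IsFaithfulNormalTrace N tr)
    {s : N.toStarSubalgebra} (hs : IsStarProjection s) : 0 ≤ tr s := by
  have := htr.nonneg s
  rwa [hs.isSelfAdjoint.star_eq, hs.isIdempotentElem.eq] at this

theorem IsFaithfulNormalTrace.projection_eq_ofReal (htr : IsFaithfulNormalTrace N tr)
    {s : N.toStarSubalgebra} (hs : IsStarProjection s) : tr s = ((tr s).re : ℂ) :=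
  Complex.eq_re_of_ofReal_le (r := 0) (by simpa using htr.projection_nonneg hs)

theorem IsFaithfulNormalTrace.projection_re_nonneg (htr : IsFaithfulNormalTrace N tr)
    {s : N.toStarSubalgebra} (hs : IsStarProjection s) : 0 ≤ (tr s).re :=
  (Complex.nonneg_iff.1 (htr.projection_nonneg hs)).1

theorem IsFaithfulNormalTrace.projection_re_pos (htr : IsFaithfulNormalTrace N tr)
    {s : N.toStarSubalgebra} (hs : IsStarProjection s) (h0 : s ≠ 0) : 0 < (tr s).re := by
  refine lt_of_le_of_ne (htr.projection_re_nonneg hs) fun h => h0 (htr.faithful s ?_)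
  rw [hs.isSelfAdjoint.star_eq, hs.isIdempotentElem.eq, htr.projection_eq_ofReal hs, ← h,
    Complex.ofReal_zero]

theorem IsFaithfulNormalTrace.projection_re_le_one (htr : IsFaithfulNormalTrace N tr)
    {s : N.toStarSubalgebra} (hs : IsStarProjection s) : (tr s).re ≤ 1 := by
  have h := htr.projection_re_nonneg hs.one_sub
  rw [map_sub, htr.map_one, Complex.sub_re, Complex.one_re] at h
  linarith

/-- A non-zero projection generates a factor with faithful trace as a two-sided ideal. -/
theorem one_mem_of_mul_mul_mem
    (hfac : ∀ z : H →L[ℂ] H, z ∈ N → z ∈ N.commutant → ∃ c : ℂ, z = c • (1 : H →L[ℂ] H))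
    (htr : IsFaithfulNormalTrace N tr) {r : N.toStarSubalgebra} (hr : IsStarProjection r)
    (hr0 : r ≠ 0) (J : AddSubmonoid N.toStarSubalgebra) (hJ : ∀ a b, a * r * b ∈ J) :
    (1 : N.toStarSubalgebra) ∈ J := by
  have hpos := htr.projection_re_pos hr hr0
  -- Peel copies of `r` off `s`. Either `s` is equivalent to a subprojection of `r` and is in `J` at
  -- once, or some `e = t r t* ≤ s` is equivalent to `r`, and `s - e` has trace smaller by `tr r`.
  have main : ∀ (n : ℕ) (s : N.toStarSubalgebra), IsStarProjection s →
      (tr s).re ≤ n * (tr r).re → s ∈ J := by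
    intro n
    induction n with
    | zero =>
      intro s hs hle
      by_contra hsJ
      have h0 : s ≠ 0 := fun h => hsJ (h ▸ J.zero_mem)
      have := htr.projection_re_pos hs h0
      simp only [Nat.cast_zero, zero_mul] at hle
      linarith
    | succ n ih =>
      intro s hs hle
      obtain ⟨T, hTN, hsTr, hpi, hcmp⟩ := exists_partialIsometry hfac
        (hs.map N.toStarSubalgebra.subtype) (hr.map N.toStarSubalgebra.subtype) s.2 r.2
      let t : N.toStarSubalgebra := ⟨T, hTN⟩
      have hstr : s * t * r = t := Subtype.ext hsTr
      have hpi' : t * (star t * t) = t := Subtype.ext hpi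
      have hst : s * t = t := by
        rw [← hstr, ← mul_assoc, ← mul_assoc, hs.isIdempotentElem.eq]
      have htr' : t * r = t := by rw [← hstr, mul_assoc, hr.isIdempotentElem.eq]
      have hts : star t * s = star t := by
        have := congrArg star hst
        rwa [star_mul, hs.isSelfAdjoint.star_eq] at this
      have hJt : t * star t ∈ J := by
        have := hJ t (star t)
        rwa [htr'] at this
      rcases hcmp with h | h
      · have h' : t * star t = s := Subtype.ext h
        exact h' ▸ hJt
      · have h' : star t * t = r := Subtype.ext h
        set e := t * star t with he
        have hee : e * e = e := by
          rw [he, mul_assoc, ← mul_assoc (star t), ← mul_assoc, hpi']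
        have hse : s * e = e := by rw [he, ← mul_assoc, hst]
        have hes : e * s = e := by rw [he, mul_assoc, hts]
        have hse' : IsStarProjection (s - e) := by
          constructor
          · change (s - e) * (s - e) = s - e
            rw [mul_sub, sub_mul, sub_mul, hs.isIdempotentElem.eq, hse, hes, hee, sub_self,
              sub_zero]
          · change star (s - e) = s - e
            rw [star_sub, hs.isSelfAdjoint.star_eq, he, star_mul, star_star]
        have htre : tr e = tr r := by rw [he, htr.tracial, h']
        have := ih (s - e) hse' (by
          rw [map_sub, Complex.sub_re, htre]
          push_cast at hle
          linarith)
        rw [← sub_add_cancel s e]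
        exact J.add_mem this hJt
  obtain ⟨n, hn⟩ := exists_nat_ge ((tr (1 : N.toStarSubalgebra)).re / (tr r).re)
  exact main n 1 (IsStarProjection.one _) ((div_le_iff₀ hpos).1 hn)

/-- `‖b‖² - b* b` has a square root in the von Neumann algebra. -/
theorem exists_star_mul_self_eq (b : N.toStarSubalgebra) :
    ∃ (C : ℝ) (c : N.toStarSubalgebra),
      star c * c = (C : ℂ) • (1 : N.toStarSubalgebra) - star b * b := by
  let B : H →L[ℂ] H := b
  let h : H →L[ℂ] H := algebraMap ℝ _ (‖B‖ ^ 2) - star B * B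
  have h0 : 0 ≤ h := sub_nonneg.2 CStarAlgebra.star_mul_le_algebraMap_norm_sq
  have hhN : h ∈ N :=
    sub_mem (by
      rw [Algebra.algebraMap_eq_smul_one]
      exact smul_mem_vonNeumann N ((‖B‖ ^ 2 : ℝ) : ℂ) (one_mem N))
      (mul_mem (star_mem b.2) b.2)
  have hsN : CFC.sqrt h ∈ N := by
    rw [← VonNeumannAlgebra.commutant_commutant N, VonNeumannAlgebra.mem_commutant_iff]
    intro g hg
    have : Commute h g := VonNeumannAlgebra.mem_commutant_iff.1 hg h hhN
    exact (this.cfcₙ_nnreal NNReal.sqrt).symm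
  refine ⟨‖B‖ ^ 2, ⟨CFC.sqrt h, hsN⟩, Subtype.ext ?_⟩
  change star (CFC.sqrt h) * CFC.sqrt h = ((‖B‖ ^ 2 : ℝ) : ℂ) • (1 : H →L[ℂ] H) - star B * B
  rw [(IsSelfAdjoint.of_nonneg (CFC.sqrt_nonneg h)).star_eq, CFC.sqrt_mul_sqrt_self h h0]
  change algebraMap ℝ _ (‖B‖ ^ 2) - star B * B = _
  rw [Algebra.algebraMap_eq_smul_one]
  rfl

theorem IsFaithfulNormalTrace.re_nonneg (htr : IsFaithfulNormalTrace N tr)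
    (x : N.toStarSubalgebra) : 0 ≤ (tr (star x * x)).re :=
  (Complex.nonneg_iff.1 (htr.nonneg x)).1

/-- Convergence to zero for the Hilbert space norm of the trace. -/
def NullSeq (tr : N.toStarSubalgebra →ₗ[ℂ] ℂ) (x : ℕ → N.toStarSubalgebra) : Prop :=
  Tendsto (fun n => (tr (star (x n) * x n)).re) atTop (𝓝 0)

theorem NullSeq.of_le (htr : IsFaithfulNormalTrace N tr) {x y : ℕ → N.toStarSubalgebra} (C : ℝ)
    (hx : NullSeq tr x)
    (h : ∀ n, (tr (star (y n) * y n)).re ≤ C * (tr (star (x n) * x n)).re) : NullSeq tr y :=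
  squeeze_zero (fun n => htr.re_nonneg _) h (by simpa using Tendsto.const_mul C hx)

theorem NullSeq.add (htr : IsFaithfulNormalTrace N tr) {x y : ℕ → N.toStarSubalgebra}
    (hx : NullSeq tr x) (hy : NullSeq tr y) : NullSeq tr fun n => x n + y n := by
  refine squeeze_zero (fun n => htr.re_nonneg _) (fun n => ?_)
    (g := fun n => 2 * ((tr (star (x n) * x n)).re + (tr (star (y n) * y n)).re)) ?_
  · have h := htr.re_nonneg (x n - y n)
    have h2 : star (x n + y n) * (x n + y n) + star (x n - y n) * (x n - y n) =
        (star (x n) * x n + star (y n) * y n) + (star (x n) * x n + star (y n) * y n) := by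
      rw [star_add, star_sub]; noncomm_ring
    have h3 := congrArg (fun z => (tr z).re) h2
    simp only [map_add, Complex.add_re] at h3
    linarith
  · simpa using (Tendsto.add hx hy).const_mul 2

/-- Writing `C - b*b = c*c`, positivity of the trace at `c x_n` bounds `‖b x_n‖₂²` by `C ‖x_n‖₂²`.
-/
theorem NullSeq.mul_left (htr : IsFaithfulNormalTrace N tr) {x : ℕ → N.toStarSubalgebra}
    (b : N.toStarSubalgebra) (hx : NullSeq tr x) : NullSeq tr fun n => b * x n := by
  obtain ⟨C, c, hc⟩ := exists_star_mul_self_eq b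
  refine hx.of_le htr C fun n => ?_
  have h := htr.re_nonneg (c * x n)
  have h1 : star (c * x n) * (c * x n) =
      (C : ℂ) • (star (x n) * x n) - star (b * x n) * (b * x n) := by
    calc star (c * x n) * (c * x n) = star (x n) * (star c * c) * x n := by
          rw [star_mul]; noncomm_ring
      _ = _ := by
          rw [hc, mul_sub, sub_mul, mul_smul_comm, smul_mul_assoc, mul_one, star_mul]
          noncomm_ring
  rw [h1, map_sub, map_smul, Complex.sub_re, smul_eq_mul, Complex.re_ofReal_mul] at h
  linarith

theorem NullSeq.star_seq (htr : IsFaithfulNormalTrace N tr) {x : ℕ → N.toStarSubalgebra}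
    (hx : NullSeq tr x) : NullSeq tr fun n => star (x n) := by
  refine hx.congr fun n => ?_
  rw [star_star, htr.tracial]

theorem NullSeq.mul_right (htr : IsFaithfulNormalTrace N tr) {x : ℕ → N.toStarSubalgebra}
    (b : N.toStarSubalgebra) (hx : NullSeq tr x) : NullSeq tr fun n => x n * b := by
  simpa using ((hx.star_seq htr).mul_left htr (star b)).star_seq htr

theorem twoNorm_smul (t : ℝ) (ht : 0 ≤ t) (x : N.toStarSubalgebra) :
    twoNorm ((t : ℂ) • tr) x = Real.sqrt t * twoNorm tr x := by
  rw [twoNorm, twoNorm, ← Real.sqrt_mul ht]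
  simp

/-- Reduces convergence in every corner to the ambient trace, since normalisation only rescales it.
-/
theorem nullSeq_iff_twoNorm (htr : IsFaithfulNormalTrace N tr) (x : ℕ → N.toStarSubalgebra)
    {t : ℝ} (ht : 0 < t) :
    Tendsto (fun n => twoNorm ((t : ℂ) • tr) (x n)) atTop (𝓝 0) ↔ NullSeq tr x := by
  simp only [twoNorm_smul t ht.le]
  constructor
  · intro h
    have h1 := (h.const_mul (Real.sqrt t)⁻¹).pow 2
    simp only [inv_mul_cancel_left₀ (Real.sqrt_pos.2 ht).ne', twoNorm,
      Real.sq_sqrt (htr.re_nonneg _)] at h1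
    simpa [NullSeq] using h1
  · intro h
    have h1 := ((Real.continuous_sqrt.tendsto 0).comp h).const_mul (Real.sqrt t)
    simpa [twoNorm, Function.comp_def] using h1

end Trace

/-! ### Spreading triviality from a subprojection -/

section Main

variable {H : Type*} [NormedAddCommGroup H] [InnerProductSpace ℂ H] [CompleteSpace H]
  {N A : VonNeumannAlgebra H} {tr : N.toStarSubalgebra →ₗ[ℂ] ℂ}

/-- A centralising sequence of a corner `qNq` which is asymptotically scalar under a non-zero
projection `r ≤ q` commuting with it is asymptotically scalar. -/
theorem nullSeq_sub_smul_of_nullSeq_mul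
    (hfac : ∀ z : H →L[ℂ] H, z ∈ N → z ∈ N.commutant → ∃ c : ℂ, z = c • (1 : H →L[ℂ] H))
    (htr : IsFaithfulNormalTrace N tr) {q r : N.toStarSubalgebra}
    (hr : IsStarProjection r) (hr0 : r ≠ 0) (hqr : q * r = r)
    {x : ℕ → N.toStarSubalgebra} (hxr : ∀ n, x n * r = r * x n)
    (hxq : ∀ n, x n * q = x n) (hqx : ∀ n, q * x n = x n)
    (hx : ∀ y, NullSeq tr fun n => x n * (q * y * q) - (q * y * q) * x n)
    (c : ℕ → ℂ) (hc : NullSeq tr fun n => x n * r - c n • r) :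
    NullSeq tr fun n => x n - c n • q := by
  let J : AddSubmonoid N.toStarSubalgebra :=
    { carrier := {z | NullSeq tr fun n => (x n - c n • q) * z}
      zero_mem' := by simp [NullSeq]
      add_mem' := fun {a b} ha hb => by
        simpa only [Set.mem_ofPred_eq, mul_add] using NullSeq.add htr ha hb }
  have h1 := one_mem_of_mul_mul_mem hfac htr hr hr0 J fun a b => by
    change NullSeq tr fun n => (x n - c n • q) * (a * r * b)
    -- `(x_n - c_n q) a r = [x_n, q a r q] r + q a (x_n r - c_n r)`, using `q r = r` and that `x_n`
    -- commutes with `r`.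
    have h2 := ((hx (a * r)).mul_right htr r).add htr (hc.mul_left htr (q * a))
    refine cast (congrArg _ (funext fun n => ?_)) (h2.mul_right htr b)
    have e1 : q * (a * r) * q * x n * r = q * a * (x n * r) := by
      rw [mul_assoc _ q (x n), hqx, mul_assoc, hxr n, mul_assoc q, mul_assoc a, ← mul_assoc r,
        hr.isIdempotentElem.eq]
      noncomm_ring
    have e2 : x n * (q * (a * r) * q) * r = x n * (a * r) := by
      rw [← mul_assoc, ← mul_assoc, hxq, mul_assoc _ q r, hqr, mul_assoc, mul_assoc,
        hr.isIdempotentElem.eq]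
    rw [sub_mul, e1, e2, mul_sub, mul_smul_comm, sub_add_sub_cancel, sub_mul, sub_mul,
      smul_mul_assoc, smul_mul_assoc]
    simp only [mul_assoc]
  have h3 : NullSeq tr fun n => (x n - c n • q) * 1 := h1
  simpa only [mul_one] using h3

theorem IsFaithfulNormalTrace.inv_eq_ofReal (htr : IsFaithfulNormalTrace N tr)
    {s : N.toStarSubalgebra} (hs : IsStarProjection s) : (tr s)⁻¹ = (((tr s).re⁻¹ : ℝ) : ℂ) := by
  rw [htr.projection_eq_ofReal hs, Complex.ofReal_re, Complex.ofReal_inv]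

theorem elementsOf_mul_mem {x y : N.toStarSubalgebra} (hx : x ∈ elementsOf N A)
    (hy : y ∈ elementsOf N A) : x * y ∈ elementsOf N A :=
  show (x : H →L[ℂ] H) * y ∈ A from mul_mem hx hy

theorem elementsOf_commute (hA : IsMasa N A) {x y : N.toStarSubalgebra} (hx : x ∈ elementsOf N A)
    (hy : y ∈ elementsOf N A) : x * y = y * x :=
  Subtype.ext (hA.prop.2 x hx y hy)

/-- If the cut of a masa by `1 - p` is totally non-`Γ`, then every projection `q` of the masa whose
cut contains a non-trivial centralising sequence lies under `p`. -/
theorem mul_one_sub_eq_zero (hfac : ∀ z : H →L[ℂ] H, z ∈ N → z ∈ N.commutant →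
      ∃ c : ℂ, z = c • (1 : H →L[ℂ] H))
    (htr : IsFaithfulNormalTrace N tr) (hA : IsMasa N A)
    {p q : N.toStarSubalgebra} (hpA : p ∈ elementsOf N A) (hp : IsStarProjection p)
    (hqA : q ∈ elementsOf N A) (hq : IsStarProjection q)
    (hcompl : IsTotallyNonGamma (cornerTrace tr (1 - p)) (corner Set.univ (1 - p))
      (cut (elementsOf N A) (1 - p)))
    (hcut : CutHasNontrivialCentralising tr Set.univ (elementsOf N A) q) :
    q * (1 - p) = 0 := by
  by_contra hr0
  set r := q * (1 - p) with hr_def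
  set s := 1 - p with hs_def
  have hsA : s ∈ elementsOf N A := sub_mem (one_mem A) hpA
  have hs : IsStarProjection s := hp.one_sub
  have hqs : q * s = s * q := elementsOf_commute hA hqA hsA
  have hr : IsStarProjection r := hq.mul hs hqs
  have hrA : r ∈ elementsOf N A := elementsOf_mul_mem hqA hsA
  have hs0 : s ≠ 0 := fun h => hr0 (by rw [hr_def, h, mul_zero])
  have hq0 : q ≠ 0 := fun h => hr0 (by rw [hr_def, h, zero_mul])
  have hsr : s * r = r := by rw [hr_def, hqs, ← mul_assoc, hs.isIdempotentElem.eq]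
  have hrs : r * s = r := by rw [hr_def, mul_assoc, hs.isIdempotentElem.eq]
  have hqr : q * r = r := by rw [hr_def, ← mul_assoc, hq.isIdempotentElem.eq]
  have hrq : r * q = r := by rw [elementsOf_commute hA hrA hqA, hqr]
  clear_value r s
  have hspos := htr.projection_re_pos hs hs0
  have hrpos := htr.projection_re_pos hr hr0
  have hqpos := htr.projection_re_pos hq hq0
  have hstr : ∀ z : N.toStarSubalgebra, (cornerTrace tr s z).re = (tr s).re⁻¹ * (tr z).re := by
    intro z
    rw [cornerTrace, htr.inv_eq_ofReal hs, LinearMap.smul_apply, smul_eq_mul,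
      Complex.re_ofReal_mul]
  have hnot : ¬ CutHasNontrivialCentralising (cornerTrace tr s) (corner Set.univ s)
      (cut (elementsOf N A) s) r := by
    intro h
    have hle : (cornerTrace tr s r).re ≤ 0 := by
      rw [← show Gamma (cornerTrace tr s) (corner Set.univ s) (cut (elementsOf N A) s) = 0
        from hcompl]
      -- A real `sSup` of an unbounded set is `0` by default, so vanishing of Γ says something only
      -- once the set is bounded; any crude bound will do.
      refine le_csSup ⟨(tr s).re⁻¹ * 1, ?_⟩ ⟨r, ⟨q, hqA, hr_def⟩, hr, h, rfl⟩
      rintro _ ⟨e, -, he, -, rfl⟩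
      rw [hstr]
      exact mul_le_mul_of_nonneg_left (htr.projection_re_le_one he) (inv_nonneg.2 hspos.le)
    rw [hstr] at hle
    have : 0 < (tr s).re⁻¹ * (tr r).re := by positivity
    linarith
  -- Passing to a corner of a corner, the factors `tr s` cancel.
  have hrtrace : cornerTrace (cornerTrace tr s) r = (((tr r).re⁻¹ : ℝ) : ℂ) • tr := by
    have hs' : (tr s)⁻¹ ≠ 0 := by
      rw [htr.inv_eq_ofReal hs]
      exact_mod_cast (inv_pos.2 hspos).ne'
    rw [← htr.inv_eq_ofReal hr, cornerTrace, cornerTrace, LinearMap.smul_apply, smul_smul,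
      smul_eq_mul, mul_inv, mul_comm, mul_inv_cancel_left₀ hs']
  have hqtrace : cornerTrace tr q = (((tr q).re⁻¹ : ℝ) : ℂ) • tr := by
    rw [cornerTrace, htr.inv_eq_ofReal hq]
  obtain ⟨x, ⟨hxB, hxc⟩, hxt⟩ := hcut
  rw [hqtrace] at hxc hxt
  have hx : ∀ y, NullSeq tr fun n => x n * (q * y * q) - (q * y * q) * x n := fun y =>
    (nullSeq_iff_twoNorm htr _ (inv_pos.2 hqpos)).1 (hxc _ ⟨y, trivial, rfl⟩)
  have hxA : ∀ n, x n ∈ elementsOf N A := fun n => by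
    obtain ⟨b, hb, h⟩ := hxB n
    rw [h]
    exact elementsOf_mul_mem hb hqA
  have hxq : ∀ n, x n * q = x n := fun n => by
    obtain ⟨b, hb, h⟩ := hxB n
    rw [h, mul_assoc, hq.isIdempotentElem.eq]
  have hqx : ∀ n, q * x n = x n := fun n => by
    rw [← elementsOf_commute hA (hxA n) hqA, hxq]
  have hxr : ∀ n, x n * r = r * x n := fun n => elementsOf_commute hA (hxA n) hrA
  have htriv : IsTrivialSeq (cornerTrace (cornerTrace tr s) r) r fun n => x n * r := by
    by_contra hnt
    refine hnot ⟨fun n => x n * r, ⟨fun n => ⟨x n * s, ⟨x n, hxA n, rfl⟩, ?_⟩, ?_⟩, hnt⟩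
    · rw [mul_assoc, hsr]
    · rintro _ ⟨_, ⟨y, -, rfl⟩, rfl⟩
      rw [hrtrace]
      refine (nullSeq_iff_twoNorm htr _ (inv_pos.2 hrpos)).2 ?_
      -- The commutator of `x_n r` with `r y r` equals that of `x_n`, because `r` commutes with
      -- `x_n`; and `r y r` lies in `qNq`.
      have h1 := hx (r * y * r)
      refine cast (congrArg _ (funext fun n => ?_)) h1
      change _ = x n * r * (r * (s * y * s) * r) - r * (s * y * s) * r * (x n * r)
      have e1 : r * (s * y * s) * r = r * y * r := by
        rw [← mul_assoc, ← mul_assoc, hrs, mul_assoc _ s r, hsr]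
      have e2 : q * (r * y * r) * q = r * y * r := by
        rw [← mul_assoc, ← mul_assoc, hqr, mul_assoc _ r q, hrq]
      rw [e1, e2, hxr n]
      have e3 : r * x n * (r * y * r) = x n * (r * y * r) := by
        rw [← hxr n]
        simp only [mul_assoc]
        rw [← mul_assoc r r, hr.isIdempotentElem.eq]
      have e4 : r * y * r * (r * x n) = r * y * r * x n := by
        rw [← mul_assoc, mul_assoc _ r r, hr.isIdempotentElem.eq]
      rw [e3, e4]
  obtain ⟨c, hc⟩ := htriv
  rw [hrtrace] at hc
  exact hxt ⟨c, (nullSeq_iff_twoNorm htr _ (inv_pos.2 hqpos)).2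
    (nullSeq_sub_smul_of_nullSeq_mul hfac htr hr hr0 hqr hxr hxq hqx hx c
      ((nullSeq_iff_twoNorm htr _ (inv_pos.2 hrpos)).1 hc))⟩

end Main

end MasaGamma

theorem lemma4p2 {H : Type*} [NormedAddCommGroup H] [InnerProductSpace ℂ H] [CompleteSpace H]
    (N A : VonNeumannAlgebra H) (hN : MasaGamma.IsII1Factor N)
    (tr : N.toStarSubalgebra →ₗ[ℂ] ℂ) (htr : MasaGamma.IsFaithfulNormalTrace N tr)
    (hA : MasaGamma.IsMasa N A)
    (p : N.toStarSubalgebra) (hpA : p ∈ MasaGamma.elementsOf N A) (hp : IsStarProjection p)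
    (hp_central : MasaGamma.CutHasNontrivialCentralising tr Set.univ
      (MasaGamma.elementsOf N A) p)
    (hp_compl : MasaGamma.IsTotallyNonGamma (MasaGamma.cornerTrace tr (1 - p))
      (MasaGamma.corner Set.univ (1 - p))
      (MasaGamma.cut (MasaGamma.elementsOf N A) (1 - p))) :
    ((MasaGamma.Gamma tr Set.univ (MasaGamma.elementsOf N A) : ℝ) : ℂ) = tr p := by
  rw [htr.projection_eq_ofReal hp]
  congr 1
  refine IsGreatest.csSup_eq ⟨⟨p, hpA, hp, hp_central, rfl⟩, ?_⟩
  rintro _ ⟨q, hqA, hq, hcut, rfl⟩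
  have h := MasaGamma.mul_one_sub_eq_zero hN.factor htr hA hpA hp hqA hq hp_compl hcut
  rw [mul_sub, mul_one, sub_eq_zero] at h
  have hpq : p * q = q := by rw [MasaGamma.elementsOf_commute hA hpA hqA, ← h]
  have := htr.projection_re_nonneg (hq.sub_of_mul_eq_right hp hpq)
  rw [map_sub, Complex.sub_re] at this
  linarith
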